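/- **Setting.** Paulis are taken modulo phase. Let $Q$ be a qubit stabiliser code (in particular, any quantum LDPC code) given by pairwise commuting checks $h_1,\dots,h_r$. Let one or more auxiliary systems be attached to $Q$ by a Clifford circuit on data and auxiliary qubits, consisting of Clifford gates and Pauli measurements. The input is an arbitrary code state of $Q$, together with auxiliary qubits prepared in a stabiliser state (or, more generally, with a fixed set of commuting stabilisers). During a window of time the auxiliary systems act, and $T$ rounds of syndrome measurement take place in this window; in addition the outcomes of auxiliary measurements are recorded. Any number of ordinary syndrome rounds on the idling $Q$ may precede and follow. During the window checks of $Q$ may be deformed onto auxiliary qubits, and data errors may be copied to auxiliary qubits, but the data errors themselves stay in place on $Q$, and the check $i$ of each round, pulled back to the input, acts on the data qubits as $h_i$. The method of measurement (surgery, homomorphic measurement, etc.) is otherwise arbitrary. **Measured representatives.** Suppose that a product of recorded outcomes, possibly together with a stabiliser of $Q$ at the output, equals a logical operator (trivial or not) of the input code state, up to stabilisers of the initial auxiliary state. The product of the data parts (pulled back to the input) of the auxiliary measurements that enter it is then a representative of that logical operator (up to stabilisers of $Q$); call it a *measured representative*. Let $S$ be a set of logical operator representatives measured by the auxiliary systems,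 i.e. the measured representatives are exactly the products of elements of $S$. Assume that the outcomes of $S$ are not known in advance: on an arbitrary code state nothing about them is determined except that equivalent representatives (those that differ by a stabiliser) have equal values. That is, every stabiliser of $Q$ which is a product of elements of $S$ is a product of factors $uv$ with $u,v\in S$ equivalent. (For example, this holds if inequivalent elements of $S$ are independent modulo stabilisers, or if $S$ is closed under products.) **Fault distance.** A phenomenological fault consists of Pauli errors on the qubits before each time step and after the last one, and flips of recorded measurement outcomes; its weight is the number of single-qubit errors plus the number of flipped outcomes. A detector is a product of outcomes, possibly with a stabiliser of $Q$ at the output, whose value is determined in the absence of faults. A logical fault is a fault that flips no detector but flips a logical observable, i.e. a logical measurement outcome or, more generally, a product of outcomes and of a logical operator of $Q$ at the output that equals a logical operator of the input in the absence of faults. The phenomenological fault distance is the minimum weight of a logical fault ($\infty$ if there is none). **Proposition.** Let $f$ be a lowest-weight Pauli fault on the data qubits of $Q$ such that * $f$ flips (anticommutes with) at least one element of $S$; * if $f$ flips an element of $S$, then it flips all elements of $S$ that are equivalent to it. Let $w$ be the weight of $f$, and let $s$ be its syndrome weight, i.e. the number of checks $h_i$ that anticommute with $f$. Then the phenomenological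 fault distance of the protocol is at most $2w+Ts$. -/

import Mathlib

open Finset

/-- Pauli operators on the qubits `ι`, modulo phase: at each qubit a pair `(x, z)`, where
`(0,0), (1,0), (0,1), (1,1)` stand for `I, X, Z, Y`. Addition is multiplication of operators. -/
abbrev Pauli (ι : Type*) : Type _ := ι → ZMod 2 × ZMod 2

namespace Pauli

/-- The symplectic form: `0` if the two operators commute, `1` if they anticommute. -/
def symp {ι : Type*} [Fintype ι] (u v : Pauli ι) : ZMod 2 :=
  ∑ i, ((u i).1 * (v i).2 + (u i).2 * (v i).1)

/-- A Pauli fault flips the value of an operator iff it anticommutes with it. -/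
def Flips {ι : Type*} [Fintype ι] (f u : Pauli ι) : Prop := symp f u = 1

/-- Number of qubits on which the operator acts nontrivially. -/
def weight {ι : Type*} [Fintype ι] (u : Pauli ι) : ℕ := hammingNorm u

/-- The part of an operator that acts on the data qubits `q`. -/
def onData {q a : Type*} (u : Pauli (q ⊕ a)) : Pauli q := fun i => u (Sum.inl i)

/-- The part of an operator that acts on the auxiliary qubits `a`. -/
def onAux {q a : Type*} (u : Pauli (q ⊕ a)) : Pauli a := fun i => u (Sum.inr i)

/-- An operator on the data qubits, extended by the identity to the auxiliary qubits. -/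
def ofData {q a : Type*} (u : Pauli q) : Pauli (q ⊕ a) := Sum.elim u (fun _ => 0)

end Pauli

/-! ### Stabiliser codes -/

/-- A qubit stabiliser code given by pairwise commuting checks (redundant checks are allowed). -/
structure StabilizerCode (q r : Type*) [Fintype q] where
  check : r → Pauli q
  check_comm : ∀ i j, Pauli.symp (check i) (check j) = 0

namespace StabilizerCode

variable {q r : Type*} [Fintype q]

/-- The stabiliser group. -/
def stabilizers (Q : StabilizerCode q r) : Submodule (ZMod 2) (Pauli q) :=
  Submodule.span (ZMod 2) (Set.range Q.check)

/-- Logical operator representatives: operators that commute with every check. -/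
def IsLogical (Q : StabilizerCode q r) (u : Pauli q) : Prop :=
  ∀ i, Pauli.symp (Q.check i) u = 0

/-- Two representatives are equivalent if they differ by a stabiliser. -/
def Equivalent (Q : StabilizerCode q r) (u v : Pauli q) : Prop := u - v ∈ Q.stabilizers

/-- Number of checks that are violated by the data fault `e`. -/
def syndromeWeight [Fintype r] (Q : StabilizerCode q r) (e : Pauli q) : ℕ :=
  #{i : r | Pauli.symp (Q.check i) e ≠ 0}

/-- `f` flips some element of `S`, and with an element of `S` it flips all elements of `S` in the
same equivalence class. -/
def FlipsClasses (Q : StabilizerCode q r) (S : Set (Pauli q)) (f : Pauli q) : Prop :=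
  (∃ u ∈ S, Pauli.Flips f u) ∧
    ∀ u ∈ S, Pauli.Flips f u → ∀ v ∈ S, Q.Equivalent u v → Pauli.Flips f v

/-- `f` is a data fault of lowest weight among those with `FlipsClasses`. -/
def IsLowestFlip (Q : StabilizerCode q r) (S : Set (Pauli q)) (f : Pauli q) : Prop :=
  Q.FlipsClasses S f ∧ ∀ g : Pauli q, Q.FlipsClasses S g → Pauli.weight f ≤ Pauli.weight g

/-- The outcomes of measuring `S` on an arbitrary code state are not known in advance.
The outcome of a product of elements of `S` is determined by the code exactly when that product is
a stabiliser. Representatives of the same class always have equal outcomes; the requirement is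
that nothing else is determined: each stabiliser that is a product of elements of `S` is a product
of factors `u * v` with `u, v ∈ S` equivalent. -/
def OutcomesUnknown (Q : StabilizerCode q r) (S : Set (Pauli q)) : Prop :=
  ∀ g ∈ Submodule.span (ZMod 2) S, g ∈ Q.stabilizers →
    g ∈ Submodule.span (ZMod 2) {p : Pauli q | ∃ u ∈ S, ∃ v ∈ S, Q.Equivalent u v ∧ p = u - v}

end StabilizerCode

/-! ### Clifford circuits with Pauli measurements, and phenomenological faults -/

/-- A circuit on the qubits `ι` with measurement outcomes labelled by `x`. Step `t < steps` applies
the Clifford gate `gate t` (through its symplectic action on Paulis modulo phase) and then measures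
the pairwise commuting Pauli operators `op y` with `time y = t`. -/
structure CliffordCircuit (ι x : Type*) [Fintype ι] where
  steps : ℕ
  gate : ℕ → (Pauli ι ≃ₗ[ZMod 2] Pauli ι)
  gate_symp : ∀ t u v, Pauli.symp (gate t u) (gate t v) = Pauli.symp u v
  time : x → ℕ
  time_lt : ∀ y, time y < steps
  op : x → Pauli ι
  op_comm : ∀ y z, time y = time z → Pauli.symp (op y) (op z) = 0

/-- A phenomenological fault: a Pauli error `data t` on the qubits just before step `t`
(`data steps` being the error after the last step), and flips of recorded measurement outcomes. -/
structure Fault (ι x : Type*) where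
  data : ℕ → Pauli ι
  meas : x → ZMod 2

namespace CliffordCircuit

variable {ι x : Type*} [Fintype ι]

/-- The product of the first `t` gates. -/
def frame (C : CliffordCircuit ι x) : ℕ → (Pauli ι ≃ₗ[ZMod 2] Pauli ι)
  | 0 => LinearEquiv.refl (ZMod 2) (Pauli ι)
  | t + 1 => (C.frame t).trans (C.gate t)

/-- A measured operator, pulled back through the gates to the input of the circuit. -/
def pullback (C : CliffordCircuit ι x) (y : x) : Pauli ι :=
  (C.frame (C.time y + 1)).symm (C.op y)

/-- The accumulated error just before step `t` (including the error that occurs there). -/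
def error (C : CliffordCircuit ι x) (F : Fault ι x) : ℕ → Pauli ι
  | 0 => F.data 0
  | t + 1 => C.gate t (C.error F t) + F.data (t + 1)

/-- Whether the recorded outcome `y` is flipped by the fault. -/
def outcomeFlip (C : CliffordCircuit ι x) (F : Fault ι x) (y : x) : ZMod 2 :=
  Pauli.symp (C.op y) (C.gate (C.time y) (C.error F (C.time y))) + F.meas y

/-- Number of single-qubit Pauli errors (over all times) plus number of flipped outcomes. -/
def faultWeight [Fintype x] (C : CliffordCircuit ι x) (F : Fault ι x) : ℕ :=
  (∑ t ∈ range (C.steps + 1), Pauli.weight (F.data t)) + #{y : x | F.meas y ≠ 0}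

/-- The operator at the input whose value equals (up to a fixed sign) the product of the
outcomes in `E` and of the operator `out` at the output, when `(E, out)` is a flow. -/
def inputOp [Fintype x] (C : CliffordCircuit ι x) (E : x → ZMod 2) (out : Pauli ι) : Pauli ι :=
  (C.frame C.steps).symm out + ∑ y, E y • C.pullback y

/-- `(E, out)` is a (stabiliser) flow: propagating `out` backwards and multiplying in the measured
operators selected by `E` gives, at each step, an operator that commutes with
all operators measured there. -/
def IsFlow [Fintype x] (C : CliffordCircuit ι x) (E : x → ZMod 2) (out : Pauli ι) : Prop :=
  ∀ z : x, Pauli.symp (C.pullback z)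
    ((C.frame C.steps).symm out + ∑ y with C.time z < C.time y, E y • C.pullback y) = 0

/-- Whether the fault flips the product of the outcomes in `E` and of `out` at the output. -/
def flowFlip [Fintype x] (C : CliffordCircuit ι x) (F : Fault ι x) (E : x → ZMod 2)
    (out : Pauli ι) : ZMod 2 :=
  (∑ y, E y * C.outcomeFlip F y) + Pauli.symp out (C.error F C.steps)

end CliffordCircuit

/-! ### Measurement by auxiliary systems -/

/-- A protocol on the data qubits of `Q` and auxiliary qubits `a`, with `R` rounds of
syndrome measurement (each records one outcome per check of `Q`) and further outcomes, labelled by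
`m`, of the auxiliary systems. The auxiliary systems act during the steps `tBegin ≤ t < tEnd`;
before and after, `Q` idles, with any number of ordinary syndrome rounds.

While the auxiliary systems act, checks of `Q` may be deformed onto auxiliary qubits, arbitrary
Paulis on data and auxiliary qubits may be measured, and Clifford gates may couple the two
(for instance, to copy data errors to an ancilla block), but `Q` remains in place:
its data errors are not moved or transformed, and the check `i` of each syndrome round acts on the
data qubits as check `i` of `Q`. -/
structure AuxProtocol {q r : Type*} [Fintype q] (Q : StabilizerCode q r) (a m : Type*) [Fintype a]
    (R : ℕ) extends CliffordCircuit (q ⊕ a) ((Fin R × r) ⊕ m) where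
  /-- Stabilisers of the initial state of the auxiliary qubits. -/
  auxInit : Submodule (ZMod 2) (Pauli a)
  auxInit_comm : ∀ u ∈ auxInit, ∀ v ∈ auxInit, Pauli.symp u v = 0
  tBegin : ℕ
  tEnd : ℕ
  tBegin_le_tEnd : tBegin ≤ tEnd
  tEnd_le_steps : tEnd ≤ steps
  roundTime : Fin R → ℕ
  roundTime_strictMono : StrictMono roundTime
  time_check : ∀ k i, time (Sum.inl (k, i)) = roundTime k
  time_aux : ∀ y : m, tBegin ≤ time (Sum.inr y) ∧ time (Sum.inr y) < tEnd
  gate_idle : ∀ t, t < tBegin ∨ tEnd ≤ t → gate t = LinearEquiv.refl (ZMod 2) (Pauli (q ⊕ a))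
  check_idle : ∀ k i, roundTime k < tBegin ∨ tEnd ≤ roundTime k →
    op (Sum.inl (k, i)) = Pauli.ofData (Q.check i)
  check_active : ∀ k i, tBegin ≤ roundTime k → roundTime k < tEnd →
    Pauli.onData (toCliffordCircuit.pullback (Sum.inl (k, i))) = Q.check i
  data_fixed : ∀ (t : ℕ) (e : Pauli q),
    Pauli.onData (toCliffordCircuit.frame t (Pauli.ofData e)) = e

namespace AuxProtocol

variable {q r a m : Type*} [Fintype q] [Fintype r] [Fintype a] [Fintype m]
  {Q : StabilizerCode q r} {R : ℕ}

/-- Number of syndrome rounds while the auxiliary systems act. -/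
def activeRounds (P : AuxProtocol Q a m R) : ℕ :=
  #{k : Fin R | P.tBegin ≤ P.roundTime k ∧ P.roundTime k < P.tEnd}

/-- A detector: a product of outcomes, possibly with a stabiliser of `Q` at the output (which is
available from the subsequent memory), whose value is determined because
it equals a stabiliser of the input state. -/
def IsDetector (P : AuxProtocol Q a m R) (E : (Fin R × r) ⊕ m → ZMod 2) (g : Pauli q) : Prop :=
  P.IsFlow E (Pauli.ofData g) ∧ g ∈ Q.stabilizers ∧
    Pauli.onData (P.inputOp E (Pauli.ofData g)) ∈ Q.stabilizers ∧
    Pauli.onAux (P.inputOp E (Pauli.ofData g)) ∈ P.auxInit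

/-- A logical observable: a product of outcomes and of a logical operator at the output that equals
a logical operator of the input code state. For `g = 0` it is a logical measurement
outcome; in general it describes the action of the protocol on the logical qubits. -/
def IsObservable (P : AuxProtocol Q a m R) (E : (Fin R × r) ⊕ m → ZMod 2) (g : Pauli q) : Prop :=
  P.IsFlow E (Pauli.ofData g) ∧ Q.IsLogical g ∧
    Q.IsLogical (Pauli.onData (P.inputOp E (Pauli.ofData g))) ∧
    Pauli.onAux (P.inputOp E (Pauli.ofData g)) ∈ P.auxInit

/-- A logical fault flips no detector, but flips some logical observable. -/
def IsLogicalFault (P : AuxProtocol Q a m R) (F : Fault (q ⊕ a) ((Fin R × r) ⊕ m)) : Prop :=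
  (∀ E g, P.IsDetector E g → P.flowFlip F E (Pauli.ofData g) = 0) ∧
    ∃ E g, P.IsObservable E g ∧ P.flowFlip F E (Pauli.ofData g) = 1

/-- The phenomenological fault distance: the least weight of a logical fault (`⊤` if there is
none). -/
noncomputable def faultDistance (P : AuxProtocol Q a m R) : ℕ∞ :=
  ⨅ (F : Fault (q ⊕ a) ((Fin R × r) ⊕ m)) (_ : P.IsLogicalFault F), (P.faultWeight F : ℕ∞)

/-- The representatives that the auxiliary systems measure: a product of outcomes yields the value
of a logical operator of the input, up to stabilisers of `Q` that are known from the syndrome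
rounds and at the output; the representative is the product of the data parts of
the auxiliary measurements that enter it. -/
def measured (P : AuxProtocol Q a m R) : Set (Pauli q) :=
  {p | ∃ (E : (Fin R × r) ⊕ m → ZMod 2) (g : Pauli q),
    P.IsFlow E (Pauli.ofData g) ∧ g ∈ Q.stabilizers ∧
    Q.IsLogical (Pauli.onData (P.inputOp E (Pauli.ofData g))) ∧
    Pauli.onAux (P.inputOp E (Pauli.ofData g)) ∈ P.auxInit ∧
    p = ∑ y : m, E (Sum.inr y) • Pauli.onData (P.pullback (Sum.inr y))}

/-- The auxiliary systems measure the representatives in `S` (hence their products), and no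
others. -/
def Measures (P : AuxProtocol Q a m R) (S : Set (Pauli q)) : Prop :=
  P.measured = (Submodule.span (ZMod 2) S : Set (Pauli q))

end AuxProtocol

namespace Pauli

section Symp

variable {ι : Type*} [Fintype ι]

lemma symp_comm (u v : Pauli ι) : symp u v = symp v u := by
  unfold symp
  exact sum_congr rfl fun i _ => by ring

lemma symp_add_left (u v w : Pauli ι) : symp (u + v) w = symp u w + symp v w := by
  unfold symp
  rw [← sum_add_distrib]
  exact sum_congr rfl fun i _ => by simp only [Pi.add_apply, Prod.fst_add, Prod.snd_add]; ring

lemma symp_smul_left (c : ZMod 2) (u w : Pauli ι) : symp (c • u) w = c * symp u w := by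
  unfold symp
  rw [mul_sum]
  exact sum_congr rfl fun i _ => by
    simp only [Pi.smul_apply, Prod.smul_fst, Prod.smul_snd, smul_eq_mul]; ring

/-- The symplectic form with a fixed second argument, as a linear form. -/
def sympLeft (w : Pauli ι) : Pauli ι →ₗ[ZMod 2] ZMod 2 where
  toFun u := symp u w
  map_add' u v := symp_add_left u v w
  map_smul' c u := symp_smul_left c u w

@[simp] lemma sympLeft_apply (u w : Pauli ι) : sympLeft w u = symp u w := rfl

@[simp] lemma symp_zero_right (u : Pauli ι) : symp u 0 = 0 := by simp [symp]

/-- The symplectic form is nondegenerate. -/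
lemma eq_of_symp_eq {u v : Pauli ι} (h : ∀ e, symp u e = symp v e) : u = v := by
  classical
  have key : ∀ (w : Pauli ι) (i : ι) (c : ZMod 2 × ZMod 2),
      symp w (Pi.single i c) = (w i).1 * c.2 + (w i).2 * c.1 := by
    intro w i c
    unfold symp
    rw [sum_eq_single i]
    · simp
    · intro j _ hj
      simp [Pi.single_eq_of_ne hj]
    · simp
  funext i
  have h1 := h (Pi.single i (0, 1))
  have h2 := h (Pi.single i (1, 0))
  rw [key, key] at h1 h2
  exact Prod.ext (by simpa using h1) (by simpa using h2)

lemma weight_zero : weight (0 : Pauli ι) = 0 := hammingNorm_zero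

lemma weight_add_le (u v : Pauli ι) : weight (u + v) ≤ weight u + weight v := by
  classical
  unfold weight hammingNorm
  refine le_trans (card_le_card ?_) (card_union_le _ _)
  intro i
  simp only [mem_filter, mem_univ, true_and, mem_union, Pi.add_apply]
  intro h
  by_contra! hc
  exact h (by rw [hc.1, hc.2, add_zero])

end Symp

section Data

variable {q a : Type*}

/-- Restriction to the data qubits, as a linear map. -/
def onDataₗ : Pauli (q ⊕ a) →ₗ[ZMod 2] Pauli q where
  toFun := onData
  map_add' _ _ := rfl
  map_smul' _ _ := rfl

lemma onData_add (u v : Pauli (q ⊕ a)) : onData (u + v) = onData u + onData v := rfl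

lemma onData_sum {κ : Type*} (s : Finset κ) (c : κ → ZMod 2) (u : κ → Pauli (q ⊕ a)) :
    onData (∑ y ∈ s, c y • u y) = ∑ y ∈ s, c y • onData (u y) :=
  map_sum onDataₗ (fun y => c y • u y) s

@[simp] lemma onData_ofData (e : Pauli q) : onData (ofData e : Pauli (q ⊕ a)) = e := rfl

variable [Fintype q] [Fintype a]

lemma symp_ofData_right (u : Pauli (q ⊕ a)) (e : Pauli q) :
    symp u (ofData e) = symp (onData u) e := by
  simp [symp, ofData, onData]

lemma symp_ofData_left (e : Pauli q) (u : Pauli (q ⊕ a)) :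
    symp (ofData e) u = symp e (onData u) := by
  rw [symp_comm, symp_ofData_right, symp_comm]

lemma weight_ofData (e : Pauli q) : weight (ofData e : Pauli (q ⊕ a)) = weight e := by
  classical
  unfold weight hammingNorm
  rw [card_filter, card_filter, Fintype.sum_sum_type]
  simp only [ofData, Sum.elim_inl, Sum.elim_inr, ne_eq, not_true_eq_false, if_false,
    sum_const_zero, add_zero]
  congr!

end Data

end Pauli

open Pauli

namespace StabilizerCode

variable {q r : Type*} [Fintype q]

lemma isLogical_of_mem_stabilizers (Q : StabilizerCode q r) {g : Pauli q}
    (hg : g ∈ Q.stabilizers) : Q.IsLogical g := by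
  intro i
  have hle : Q.stabilizers ≤ LinearMap.ker (sympLeft (Q.check i)) :=
    Submodule.span_le.2 <| by
      rintro _ ⟨j, rfl⟩
      exact Q.check_comm j i
  rw [symp_comm]
  exact hle hg

/-- If `f` flips classes of `S` as a whole and nothing about `S` is known in advance, then `f`
commutes with all stabilisers that are products of elements of `S`. -/
lemma symp_eq_zero_of_flipsClasses (Q : StabilizerCode q r) {S : Set (Pauli q)} {f g : Pauli q}
    (hS : Q.OutcomesUnknown S) (hf : Q.FlipsClasses S f) (hg : g ∈ Submodule.span (ZMod 2) S)
    (hgQ : g ∈ Q.stabilizers) : symp g f = 0 := by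
  have hle : Submodule.span (ZMod 2)
      {p : Pauli q | ∃ u ∈ S, ∃ v ∈ S, Q.Equivalent u v ∧ p = u - v} ≤
      LinearMap.ker (sympLeft f) := Submodule.span_le.2 <| by
    rintro _ ⟨u, hu, v, hv, huv, rfl⟩
    have hvu : Q.Equivalent v u := by
      unfold Equivalent at huv ⊢
      rw [← neg_sub]
      exact neg_mem huv
    have h1 := hf.2 u hu
    have h2 := hf.2 v hv
    have hbin : ∀ c d : ZMod 2, (c = 1 → d = 1) → (d = 1 → c = 1) → c = d := by decide
    simp only [SetLike.mem_coe, LinearMap.mem_ker, map_sub, sympLeft_apply]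
    rw [sub_eq_zero, symp_comm u, symp_comm v]
    exact hbin _ _ (fun h => h1 h v hv huv) fun h => h2 h u hu hvu
  exact hle (hS g hg hgQ)

end StabilizerCode

namespace CliffordCircuit

variable {ι x : Type*} [Fintype ι]

lemma frame_succ_apply (C : CliffordCircuit ι x) (t : ℕ) (u : Pauli ι) :
    C.frame (t + 1) u = C.gate t (C.frame t u) := rfl

lemma symp_frame (C : CliffordCircuit ι x) (t : ℕ) (u v : Pauli ι) :
    symp (C.frame t u) (C.frame t v) = symp u v := by
  induction t with
  | zero => rfl
  | succ t ih => rw [frame_succ_apply, frame_succ_apply, C.gate_symp, ih]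

lemma symp_frame_symm_left (C : CliffordCircuit ι x) (t : ℕ) (u v : Pauli ι) :
    symp ((C.frame t).symm u) v = symp u (C.frame t v) := by
  rw [← C.symp_frame t, LinearEquiv.apply_symm_apply]

end CliffordCircuit

namespace AuxProtocol

variable {q r a m : Type*} [Fintype q] [Fintype a] {Q : StabilizerCode q r} {R : ℕ}

lemma frame_of_le_tBegin (P : AuxProtocol Q a m R) {t : ℕ} (ht : t ≤ P.tBegin)
    (u : Pauli (q ⊕ a)) : P.frame t u = u := by
  induction t with
  | zero => rfl
  | succ t ih =>
    rw [CliffordCircuit.frame_succ_apply, ih (by omega), P.gate_idle t (Or.inl (by omega))]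
    rfl

lemma onData_frame_symm_ofData (P : AuxProtocol Q a m R) (t : ℕ) (g : Pauli q) :
    onData ((P.frame t).symm (ofData g)) = g := by
  refine eq_of_symp_eq fun e => ?_
  rw [← symp_ofData_right, CliffordCircuit.symp_frame_symm_left, symp_ofData_left, P.data_fixed]

/-- In every round, check `i` pulled back to the input acts on the data qubits as check `i`
of the code. -/
lemma onData_pullback_check (P : AuxProtocol Q a m R) (k : Fin R) (i : r) :
    onData (P.pullback (Sum.inl (k, i))) = Q.check i := by
  by_cases h : P.roundTime k < P.tBegin ∨ P.tEnd ≤ P.roundTime k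
  · unfold CliffordCircuit.pullback
    rw [P.check_idle k i h, P.onData_frame_symm_ofData]
  · push Not at h
    exact P.check_active k i h.1 h.2

/-- The data fault `f` at the beginning and at the end of the window, together with flips of all
check outcomes in the window that `f` violates. -/
def windowFault (P : AuxProtocol Q a m R) (f : Pauli q) :
    Fault (q ⊕ a) ((Fin R × r) ⊕ m) where
  data t := (if t = P.tBegin then ofData f else 0) + (if t = P.tEnd then ofData f else 0)
  meas := Sum.elim
    (fun p => if P.tBegin ≤ P.roundTime p.1 ∧ P.roundTime p.1 < P.tEnd
      then symp (Q.check p.2) f else 0)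
    (fun _ => 0)

lemma error_windowFault (P : AuxProtocol Q a m R) (f : Pauli q) (t : ℕ) :
    P.error (P.windowFault f) t =
      (if P.tBegin ≤ t then P.frame t (ofData f) else 0) +
        (if P.tEnd ≤ t then ofData f else 0) := by
  induction t with
  | zero =>
    simp only [CliffordCircuit.error, windowFault, Nat.le_zero, eq_comm (a := 0)]
    rfl
  | succ t ih =>
    have h1 : (if P.tBegin ≤ t + 1 then P.frame (t + 1) (ofData f) else 0) =
        P.gate t (if P.tBegin ≤ t then P.frame t (ofData f) else 0) +
          (if t + 1 = P.tBegin then ofData f else 0) := by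
      rcases lt_trichotomy (t + 1) P.tBegin with h | h | h
      · simp [show ¬ P.tBegin ≤ t + 1 by omega, show ¬ P.tBegin ≤ t by omega, h.ne]
      · simp [show ¬ P.tBegin ≤ t by omega, h, P.frame_of_le_tBegin le_rfl]
      · simp [show P.tBegin ≤ t + 1 by omega, show P.tBegin ≤ t by omega, h.ne',
          CliffordCircuit.frame_succ_apply]
    have h2 : (if P.tEnd ≤ t + 1 then (ofData f : Pauli (q ⊕ a)) else 0) =
        P.gate t (if P.tEnd ≤ t then ofData f else 0) +
          (if t + 1 = P.tEnd then ofData f else 0) := by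
      rcases lt_trichotomy (t + 1) P.tEnd with h | h | h
      · simp [show ¬ P.tEnd ≤ t + 1 by omega, show ¬ P.tEnd ≤ t by omega, h.ne]
      · simp [show ¬ P.tEnd ≤ t by omega, h]
      · simp [show P.tEnd ≤ t + 1 by omega, show P.tEnd ≤ t by omega, h.ne',
          P.gate_idle t (Or.inr (by omega))]
    rw [CliffordCircuit.error, ih, h1, h2, map_add]
    simp only [windowFault]
    abel

lemma onData_error_windowFault (P : AuxProtocol Q a m R) (f : Pauli q) {t : ℕ}
    (ht : P.tEnd ≤ t) : onData (P.error (P.windowFault f) t) = 0 := by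
  rw [error_windowFault, if_pos (P.tBegin_le_tEnd.trans ht), if_pos ht, onData_add,
    P.data_fixed, onData_ofData]
  funext i
  exact Prod.ext (CharTwo.add_self_eq_zero _) (CharTwo.add_self_eq_zero _)

lemma symp_op_error_active (P : AuxProtocol Q a m R) (f : Pauli q) (y : (Fin R × r) ⊕ m)
    (h1 : P.tBegin ≤ P.time y) (h2 : P.time y < P.tEnd) :
    symp (P.op y) (P.gate (P.time y) (P.error (P.windowFault f) (P.time y))) =
      symp (onData (P.pullback y)) f := by
  rw [error_windowFault, if_pos h1, if_neg h2.not_ge, add_zero,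
    ← CliffordCircuit.frame_succ_apply, ← CliffordCircuit.symp_frame_symm_left,
    symp_ofData_right]
  rfl

lemma outcomeFlip_check (P : AuxProtocol Q a m R) (f : Pauli q) (k : Fin R) (i : r) :
    P.outcomeFlip (P.windowFault f) (Sum.inl (k, i)) = 0 := by
  unfold CliffordCircuit.outcomeFlip
  have ht := P.time_check k i
  by_cases h : P.tBegin ≤ P.roundTime k ∧ P.roundTime k < P.tEnd
  · rw [P.symp_op_error_active f _ (by omega) (by omega), P.onData_pullback_check]
    simp only [windowFault, Sum.elim_inl, if_pos h]
    exact CharTwo.add_self_eq_zero _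
  · have h' : P.roundTime k < P.tBegin ∨ P.tEnd ≤ P.roundTime k := by omega
    have hm : (P.windowFault f).meas (Sum.inl (k, i)) = 0 := by
      simp only [windowFault, Sum.elim_inl, if_neg h]
    rw [hm, add_zero, ht, P.gate_idle _ h', P.check_idle k i h', LinearEquiv.refl_apply,
      symp_ofData_left]
    rcases h' with h' | h'
    · have h'' := P.tBegin_le_tEnd
      rw [error_windowFault, if_neg (by omega), if_neg (by omega), add_zero]
      exact symp_zero_right _
    · rw [P.onData_error_windowFault f h', symp_zero_right]

lemma outcomeFlip_aux (P : AuxProtocol Q a m R) (f : Pauli q) (y : m) :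
    P.outcomeFlip (P.windowFault f) (Sum.inr y) =
      symp (onData (P.pullback (Sum.inr y))) f := by
  unfold CliffordCircuit.outcomeFlip
  rw [P.symp_op_error_active f _ (P.time_aux y).1 (P.time_aux y).2]
  exact add_zero _

lemma sum_weight_windowFault_le (P : AuxProtocol Q a m R) (f : Pauli q) (s : Finset ℕ) :
    ∑ t ∈ s, weight ((P.windowFault f).data t) ≤ 2 * weight f := by
  have hite : ∀ t b : ℕ, weight (if t = b then (ofData f : Pauli (q ⊕ a)) else 0) =
      if t = b then weight f else 0 := by
    intro t b
    split_ifs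
    · exact weight_ofData f
    · exact weight_zero
  have hsum : ∀ b : ℕ, (∑ t ∈ s, if t = b then weight f else 0) ≤ weight f := by
    intro b
    rw [sum_ite_eq']
    split_ifs <;> simp
  calc ∑ t ∈ s, weight ((P.windowFault f).data t)
      ≤ ∑ t ∈ s, ((if t = P.tBegin then weight f else 0) +
          if t = P.tEnd then weight f else 0) :=
        sum_le_sum fun t _ => (weight_add_le _ _).trans_eq (by rw [hite, hite])
    _ ≤ 2 * weight f := by
        rw [sum_add_distrib, two_mul]
        exact add_le_add (hsum _) (hsum _)

variable [Fintype r] [Fintype m]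

/-- The product of the data parts of the auxiliary measurements selected by `E`. -/
def representative (P : AuxProtocol Q a m R) (E : (Fin R × r) ⊕ m → ZMod 2) : Pauli q :=
  ∑ y : m, E (Sum.inr y) • onData (P.pullback (Sum.inr y))

lemma flowFlip_windowFault (P : AuxProtocol Q a m R) (f g : Pauli q)
    (E : (Fin R × r) ⊕ m → ZMod 2) :
    P.flowFlip (P.windowFault f) E (ofData g) = symp (P.representative E) f := by
  unfold CliffordCircuit.flowFlip representative
  rw [symp_ofData_left, P.onData_error_windowFault f P.tEnd_le_steps, symp_zero_right, add_zero,
    Fintype.sum_sum_type, ← sympLeft_apply, map_sum]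
  have hc : ∀ p, P.outcomeFlip (P.windowFault f) (Sum.inl p) = 0 :=
    fun p => P.outcomeFlip_check f p.1 p.2
  simp [hc, outcomeFlip_aux]

lemma onData_inputOp (P : AuxProtocol Q a m R) (E : (Fin R × r) ⊕ m → ZMod 2) (g : Pauli q) :
    onData (P.inputOp E (ofData g)) =
      g + ((∑ p : Fin R × r, E (Sum.inl p) • Q.check p.2) + P.representative E) := by
  unfold CliffordCircuit.inputOp representative
  rw [onData_add, onData_sum, P.onData_frame_symm_ofData, Fintype.sum_sum_type]
  have hc : ∀ p, onData (P.pullback (Sum.inl p)) = Q.check p.2 :=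
    fun p => P.onData_pullback_check p.1 p.2
  simp only [hc]

lemma representative_mem_stabilizers (P : AuxProtocol Q a m R)
    {E : (Fin R × r) ⊕ m → ZMod 2} {g : Pauli q} (hg : g ∈ Q.stabilizers)
    (h : onData (P.inputOp E (ofData g)) ∈ Q.stabilizers) :
    P.representative E ∈ Q.stabilizers := by
  rw [onData_inputOp, Submodule.add_mem_iff_right _ hg, Submodule.add_mem_iff_right] at h
  · exact h
  · exact sum_mem fun p _ => Submodule.smul_mem _ _ (Submodule.subset_span ⟨p.2, rfl⟩)

lemma isLogicalFault_windowFault (P : AuxProtocol Q a m R) {S : Set (Pauli q)}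
    (hmeas : P.Measures S) (hS : Q.OutcomesUnknown S) {f : Pauli q}
    (hf : Q.FlipsClasses S f) : P.IsLogicalFault (P.windowFault f) := by
  constructor
  · rintro E g ⟨hflow, hg, hdata, haux⟩
    rw [flowFlip_windowFault]
    refine Q.symp_eq_zero_of_flipsClasses hS hf ?_ (P.representative_mem_stabilizers hg hdata)
    rw [← SetLike.mem_coe, ← hmeas]
    exact ⟨E, g, hflow, hg, Q.isLogical_of_mem_stabilizers hdata, haux, rfl⟩
  · obtain ⟨u, hu, hfu⟩ := hf.1
    have hu' : u ∈ P.measured := by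
      rw [hmeas]
      exact Submodule.subset_span hu
    obtain ⟨E, g, hflow, hg, hdata, haux, rfl⟩ := hu'
    refine ⟨E, g, ⟨hflow, Q.isLogical_of_mem_stabilizers hg, hdata, haux⟩, ?_⟩
    rw [flowFlip_windowFault, symp_comm]
    exact hfu

lemma card_meas_windowFault_le (P : AuxProtocol Q a m R) (f : Pauli q) :
    #{y | (P.windowFault f).meas y ≠ 0} ≤ P.activeRounds * Q.syndromeWeight f := by
  unfold activeRounds StabilizerCode.syndromeWeight
  rw [← card_product]
  refine (card_le_card fun y hy => ?_).trans_eq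
    (card_map (Function.Embedding.inl (α := Fin R × r) (β := m)))
  rw [mem_filter] at hy
  rcases y with ⟨k, i⟩ | y
  · have h := hy.2
    simp only [windowFault, Sum.elim_inl, ne_eq, ite_eq_right_iff, not_forall] at h
    obtain ⟨hk, hi⟩ := h
    exact mem_map.2 ⟨(k, i), by simp [hk, hi], rfl⟩
  · exact absurd rfl hy.2

lemma faultWeight_windowFault_le (P : AuxProtocol Q a m R) (f : Pauli q) :
    P.faultWeight (P.windowFault f) ≤ 2 * weight f + P.activeRounds * Q.syndromeWeight f :=
  add_le_add (P.sum_weight_windowFault_le f _) (P.card_meas_windowFault_le f)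

end AuxProtocol

theorem mainTheorem7 {q r a m : Type*} [Fintype q] [Fintype r] [Fintype a] [Fintype m]
    (Q : StabilizerCode q r) (R : ℕ) (P : AuxProtocol Q a m R)
    (S : Set (Pauli q)) (hlog : ∀ u ∈ S, Q.IsLogical u)
    (hmeas : P.Measures S) (hunknown : Q.OutcomesUnknown S)
    (f : Pauli q) (hf : Q.IsLowestFlip S f)
    (w s T : ℕ) (hw : w = Pauli.weight f) (hs : s = Q.syndromeWeight f)
    (hT : T = P.activeRounds) :
    P.faultDistance ≤ ((2 * w + T * s : ℕ) : ℕ∞) := by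
  subst hw hs hT
  exact (iInf₂_le _ (P.isLogicalFault_windowFault hmeas hunknown hf.1)).trans
    (Nat.cast_le.2 (P.faultWeight_windowFault_le f))
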